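/- Let $J,R,Q\in\mathbb{R}^{n\times n}$ and $B\in\mathbb{R}^{n\times m}$ with $J=-J^{T}$, $R=R^{T}\succeq 0$, $Q=Q^{T}\succ 0$, put $A=(J-R)Q$ and $C=B^{T}Q$, and suppose that $(A,B,C)$ is minimal, i.e. controllable and observable. Let $\bar n\ge 2$ and let $w_{ij}\ge 0$ ($1\le i\ne j\le\bar n$) be coupling weights. Let $L\in\mathbb{R}^{\bar n\times\bar n}$ be the Laplacian $(L)_{ij}=-w_{ij}$ for $i\neq j$, $(L)_{ii}=\sum_{j\ne i}w_{ij}$, and let $G\in\mathbb{R}^{\bar n\times\bar m}$, $H\in\mathbb{R}^{\bar p\times\bar n}$. Consider the networked system $$\Sigma:\quad \dot x=(I\otimes A-L\otimes BC)x+(G\otimes B)u,\qquad y=(H\otimes C)x .$$ Let $\mathcal G$ be the directed graph on $\{1,\dots,\bar n\}$ with an arc from $i$ to $j\neq i$ if and only if $w_{ji}>0$, and let $\mathcal G_{\mathrm u}$ be the undirected graph with an edge between $i\ne j$ if and only if $w_{ij}+w_{ji}>0$. Assume that 1. $\mathcal G_{\mathrm u}$ is a tree; 2. $\mathcal G$ contains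 a directed rooted spanning tree as a subgraph, i.e. a directed tree on all $\bar n$ vertices in which the root has no incoming arc and every other vertex has exactly one incoming arc. Let the vertices be numbered such that $i=\bar n-1$ and $j=\bar n$ are adjacent in $\mathcal G_{\mathrm u}$, and define $V,W\in\mathbb{R}^{\bar n\times(\bar n-1)}$ by $$V=\begin{bmatrix} I&0\\0&1\\0&1\end{bmatrix},\qquad W=\begin{bmatrix} I&0\\0&\frac{w_{ji}}{w_{ij}+w_{ji}}\\0&\frac{w_{ij}}{w_{ij}+w_{ji}}\end{bmatrix}.$$ Let $\hat\Sigma$ be the one-step clustered system obtained from $\Sigma$ by the Petrov–Galerkin projection with $V\otimes I$ and $W\otimes I$, that is $$\hat\Sigma:\quad \dot\xi=(I\otimes A-\hat L\otimes BC)\xi+(\hat G\otimes B)u,\qquad \hat y=(\hat H\otimes C)\xi,$$ with $\hat L=W^{T}LV$, $\hat G=W^{T}G$, $\hat H=HV$ and $\xi^{T}=[\xi_1^{T}\ \cdots\ \xi_{\bar n-1}^{T}]$, $\xi_i(t)\in\mathbb{R}^n$. Then any trajectory $\xi$ of $\hat\Sigma$ on $[0,\infty)$ for $u=0$ satisfies,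 for all $i,j\in\{1,\dots,\bar n-1\}$, $$\lim_{t\to\infty}\big(\xi_i(t)-\xi_j(t)\big)=0 .$$ -/

import Mathlib

open Filter Topology
open scoped Matrix Kronecker

noncomputable section

namespace ClusteredNetwork

/-! ### Linear systems -/

/-- A linear system `x' = A x + B u`, `y = C x`. -/
structure LinearSystem (σ ι ο : Type*) where
  A : Matrix σ σ ℝ
  B : Matrix σ ι ℝ
  C : Matrix ο σ ℝ

namespace LinearSystem

variable {σ ι ο : Type*} [Fintype σ] [Fintype ι]

/-- `x` is a trajectory on `[0, ∞)` of the system under the input `u`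
(one-sided derivative at `t = 0`). -/
def IsTrajectory (S : LinearSystem σ ι ο) (u : ℝ → ι → ℝ) (x : ℝ → σ → ℝ) : Prop :=
  ∀ t : ℝ, 0 ≤ t → HasDerivWithinAt x (S.A *ᵥ x t + S.B *ᵥ u t) (Set.Ici 0) t

/-- The reachable subspace, spanned by the ranges of `Aᵏ B`, is the whole state space. -/
def IsControllable [DecidableEq σ] (S : LinearSystem σ ι ο) : Prop :=
  (⨆ k : ℕ, LinearMap.range (S.A ^ k * S.B).mulVecLin) = ⊤

/-- The unobservable subspace, the intersection of the kernels of `C Aᵏ`, is trivial. -/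
def IsObservable [DecidableEq σ] (S : LinearSystem σ ι ο) : Prop :=
  (⨅ k : ℕ, LinearMap.ker (S.C * S.A ^ k).mulVecLin) = ⊥

/-- A (finite-dimensional) realization is minimal: controllable and observable. -/
def IsMinimal [DecidableEq σ] (S : LinearSystem σ ι ο) : Prop :=
  S.IsControllable ∧ S.IsObservable

/-- Petrov–Galerkin projection: approximate `x ≈ V ξ` and project the dynamics by `W`. -/
def project {ρ : Type*} (S : LinearSystem σ ι ο) (V W : Matrix σ ρ ℝ) : LinearSystem ρ ι ο where
  A := Wᵀ * S.A * V
  B := Wᵀ * S.B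
  C := S.C * V

end LinearSystem

/-- The data of a subsystem in port-Hamiltonian form:
`x' = (J - R) Q x + B v`, `z = Bᵀ Q x`, with `n` states and `m` inputs and outputs. -/
structure PortHamiltonian (n m : ℕ) where
  J : Matrix (Fin n) (Fin n) ℝ
  R : Matrix (Fin n) (Fin n) ℝ
  Q : Matrix (Fin n) (Fin n) ℝ
  B : Matrix (Fin n) (Fin m) ℝ
  J_skew : Jᵀ = -J
  R_posSemidef : R.PosSemidef
  Q_posDef : Q.PosDef

namespace PortHamiltonian

variable {n m : ℕ}

/-- `A = (J - R) Q`. -/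
def A (P : PortHamiltonian n m) : Matrix (Fin n) (Fin n) ℝ := (P.J - P.R) * P.Q

/-- `C = Bᵀ Q`. -/
def C (P : PortHamiltonian n m) : Matrix (Fin m) (Fin n) ℝ := P.Bᵀ * P.Q

/-- The subsystem as a linear system. -/
def toLinearSystem (P : PortHamiltonian n m) : LinearSystem (Fin n) (Fin m) (Fin m) where
  A := P.A
  B := P.B
  C := P.C

end PortHamiltonian

/-! ### Interconnections and their graphs -/

/-- The interconnection data of a network with `q` vertices, `r` external inputs and `s` external
outputs: `v i = ∑_{j ≠ i} w i j (z j - z i) + ∑ j, G i j u j`, `y i = ∑ j, H i j z j`.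
The diagonal of `w` plays no role. -/
structure Interconnection (q r s : ℕ) where
  w : Matrix (Fin q) (Fin q) ℝ
  G : Matrix (Fin q) (Fin r) ℝ
  H : Matrix (Fin s) (Fin q) ℝ
  w_nonneg : ∀ i j, i ≠ j → 0 ≤ w i j

namespace Interconnection

variable {q r s : ℕ}

/-- The Laplacian: `-w i j` off the diagonal, `∑_{j ≠ i} w i j` on it. -/
def laplacian (K : Interconnection q r s) : Matrix (Fin q) (Fin q) ℝ :=
  Matrix.of fun i j => if i = j then ∑ k ∈ Finset.univ.erase i, K.w i k else -K.w i j

/-- The directed graph, with an arc from `i` to `j` if and only if `w j i > 0`. -/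
def digraph (K : Interconnection q r s) : Digraph (Fin q) where
  Adj i j := i ≠ j ∧ 0 < K.w j i

/-- The underlying undirected graph, with an edge `{i, j}` if and only if `w i j + w j i > 0`. -/
def underlyingGraph (K : Interconnection q r s) : SimpleGraph (Fin q) where
  Adj i j := i ≠ j ∧ 0 < K.w i j + K.w j i
  symm := ⟨fun i j h => ⟨h.1.symm, by rw [add_comm]; exact h.2⟩⟩
  loopless := ⟨fun _ h => h.1 rfl⟩

end Interconnection

/-- A directed rooted spanning tree: a directed tree connecting all vertices, in which the root has
no incoming arc and every other vertex has exactly one incoming arc. -/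
def IsDirectedRootedSpanningTree {α : Type*} (T : Digraph α) : Prop :=
  (∀ a b, T.Adj a b → ¬ T.Adj b a) ∧ T.toSimpleGraphInclusive.IsTree ∧
    ∃ root, (∀ a, ¬ T.Adj a root) ∧ ∀ b, b ≠ root → ∃! a, T.Adj a b

/-- The standing assumption on the interconnection: the underlying undirected graph is a tree, and
the directed graph contains a directed rooted spanning tree as a subgraph. -/
def Interconnection.TreeAssumption {q r s : ℕ} (K : Interconnection q r s) : Prop :=
  K.underlyingGraph.IsTree ∧ ∃ T : Digraph (Fin q), T ≤ K.digraph ∧ IsDirectedRootedSpanningTree T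

/-! ### The networked system and its one-step clustering -/

/-- The system `x' = (I ⊗ A - L ⊗ B C) x + (G ⊗ B) u`, `y = (H ⊗ C) x`; the state `x i` of the
`i`-th subsystem is `fun a => x (i, a)`. -/
def coupledSystem {n m q r s : ℕ} (P : PortHamiltonian n m) (L : Matrix (Fin q) (Fin q) ℝ)
    (G : Matrix (Fin q) (Fin r) ℝ) (H : Matrix (Fin s) (Fin q) ℝ) :
    LinearSystem (Fin q × Fin n) (Fin r × Fin m) (Fin s × Fin m) where
  A := (1 : Matrix (Fin q) (Fin q) ℝ) ⊗ₖ P.A - L ⊗ₖ (P.B * P.C)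
  B := G ⊗ₖ P.B
  C := H ⊗ₖ P.C

/-- The networked system. -/
def networkedSystem {n m q r s : ℕ} (P : PortHamiltonian n m) (K : Interconnection q r s) :
    LinearSystem (Fin q × Fin n) (Fin r × Fin m) (Fin s × Fin m) :=
  coupledSystem P K.laplacian K.G K.H

/-- In a network with `N + 2` vertices, the last but one vertex, to be clustered with the last. -/
abbrev vi (N : ℕ) : Fin (N + 2) := (Fin.last N).castSucc

/-- In a network with `N + 2` vertices, the last vertex. -/
abbrev vj (N : ℕ) : Fin (N + 2) := Fin.last (N + 1)

/-- The projection matrix with block rows `[I 0]`, `[0 1]`, `[0 1]`. -/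
def projV (N : ℕ) : Matrix (Fin (N + 2)) (Fin (N + 1)) ℝ :=
  Matrix.of fun k a =>
    if a = Fin.last N then (if k = vi N ∨ k = vj N then 1 else 0)
    else (if k = a.castSucc then 1 else 0)

/-- The projection matrix with block rows `[I 0]`, `[0 w_ji / (w_ij + w_ji)]`,
`[0 w_ij / (w_ij + w_ji)]`, where `i` and `j` are the last but one and the last vertex. -/
def projW {N : ℕ} (w : Matrix (Fin (N + 2)) (Fin (N + 2)) ℝ) :
    Matrix (Fin (N + 2)) (Fin (N + 1)) ℝ :=
  Matrix.of fun k a =>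
    if a = Fin.last N then
      (if k = vi N then w (vj N) (vi N) / (w (vi N) (vj N) + w (vj N) (vi N))
       else if k = vj N then w (vi N) (vj N) / (w (vi N) (vj N) + w (vj N) (vi N))
       else 0)
    else (if k = a.castSucc then 1 else 0)

/-- The one-step clustered system, with `L̂ = Wᵀ L V`, `Ĝ = Wᵀ G` and `Ĥ = H V`. -/
def clusteredSystem {n m N r s : ℕ} (P : PortHamiltonian n m) (K : Interconnection (N + 2) r s) :
    LinearSystem (Fin (N + 1) × Fin n) (Fin r × Fin m) (Fin s × Fin m) :=
  coupledSystem P ((projW K.w)ᵀ * K.laplacian * projV N) ((projW K.w)ᵀ * K.G) (K.H * projV N)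

theorem projW_transpose_mul_projV {N : ℕ} (w : Matrix (Fin (N + 2)) (Fin (N + 2)) ℝ)
    (h : 0 < w (vi N) (vj N) + w (vj N) (vi N)) : (projW w)ᵀ * projV N = 1 := by
  ext a b
  rw [Matrix.mul_apply, Fin.sum_univ_castSucc, Fin.sum_univ_castSucc]
  have h1 : w (vj N) (vi N) / (w (vi N) (vj N) + w (vj N) (vi N)) +
      w (vi N) (vj N) / (w (vi N) (vj N) + w (vj N) (vi N)) = 1 := by
    field_simp
    ring
  have hne (x : Fin N) : x.castSucc.castSucc ≠ Fin.last (N + 1) := Fin.castSucc_ne_last _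
  have hne2 (x : Fin N) : Fin.last N ≠ x.castSucc := (Fin.castSucc_ne_last _).symm
  have hne3 (x : Fin (N + 1)) : Fin.last (N + 1) ≠ x.castSucc := (Fin.castSucc_ne_last _).symm
  induction a using Fin.lastCases <;> induction b using Fin.lastCases <;>
    simp_all [projV, projW, vi, vj, Matrix.one_apply, eq_comm]

/-- The one-step clustered system is the Petrov–Galerkin projection of the networked system by
`V ⊗ I` and `W ⊗ I`. -/
theorem clusteredSystem_eq_project {n m N r s : ℕ} (P : PortHamiltonian n m)
    (K : Interconnection (N + 2) r s) (h : K.underlyingGraph.Adj (vi N) (vj N)) :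
    clusteredSystem P K = (networkedSystem P K).project
      (projV N ⊗ₖ (1 : Matrix (Fin n) (Fin n) ℝ)) (projW K.w ⊗ₖ (1 : Matrix (Fin n) (Fin n) ℝ)) := by
  have h1 := projW_transpose_mul_projV K.w h.2
  have h2 : (projW K.w ⊗ₖ (1 : Matrix (Fin n) (Fin n) ℝ))ᵀ = (projW K.w)ᵀ ⊗ₖ 1 := by
    rw [← Matrix.kroneckerMap_transpose, Matrix.transpose_one]
  simp only [clusteredSystem, networkedSystem, coupledSystem, LinearSystem.project, h2,
    Matrix.mul_sub, Matrix.sub_mul, ← Matrix.mul_kronecker_mul, Matrix.one_mul, Matrix.mul_one, h1]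

end ClusteredNetwork

end

/-! The matrix `L̂ = Wᵀ L V` is again a Laplacian, since `V` sums the columns of a cluster and `W`
combines its rows with nonnegative weights. Some clustered vertex still reaches all others. A tree
is minimally connected, so the directed spanning tree `T` uses every edge of the underlying graph.
In particular it contains an arc between the merged vertices, say i → j. Then w_ji > 0, so vertex i
has positive weight in `W` and arcs into i survive. The only arc of `T` into j comes from i and is
absorbed by the cluster, so the weight of j is irrelevant.

For such a Laplacian the kernel consists of the consensus vectors, 0 is semisimple (both by the
maximum principle), and all other eigenvalues ν have positive real part (Gershgorin). For these ν,
`A - ν B C` is Hurwitz by an energy estimate with `Q` and observability. In place of a Jordan form,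
the factors of the minimal polynomial of `L̂ ⊗ I` are removed one at a time, each step being a
Hurwitz equation with vanishing input. This gives `(L̂ ⊗ I) ξ → 0`. Differences of subsystem states
vanish on the kernel of `L̂ ⊗ I`, so they tend to 0 as well, although `ξ` itself need not converge.
-/

namespace ClusteredNetwork

/-! ### Linear equations with vanishing input -/

section StableODE

variable {E : Type*} [NormedAddCommGroup E] [NormedSpace ℂ E]

/-- A stable scalar mode driven by a vanishing input vanishes. -/
theorem tendsto_zero_of_hasDerivWithinAt_smul_add {μ : ℂ} (hμ : μ.re < 0) {y g : ℝ → E}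
    (hy : ∀ t : ℝ, 0 ≤ t → HasDerivWithinAt y (μ • y t + g t) (Set.Ici 0) t)
    (hg : Tendsto g atTop (𝓝 0)) : Tendsto y atTop (𝓝 0) := by
  obtain ⟨c, hc, hcμ⟩ : ∃ c : ℝ, 0 < c ∧ c = -μ.re := ⟨-μ.re, by linarith, rfl⟩
  let e : ℝ → ℂ := fun t => Complex.exp (-μ * t)
  have he : ∀ t, HasDerivAt e (e t * -μ) t := fun t => by
    have h : HasDerivAt (fun s : ℝ => -μ * (s : ℂ)) (-μ) t := by
      simpa using (Complex.ofRealCLM.hasDerivAt (x := t)).const_mul (-μ)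
    exact h.cexp
  have hen : ∀ t, ‖e t‖ = Real.exp (c * t) := fun t => by
    simp [e, Complex.norm_exp, hcμ]
  have hh : ∀ t : ℝ, 0 ≤ t → HasDerivWithinAt (fun s => e s • y s) (e t • g t) (Set.Ici 0) t := by
    intro t ht
    have h := (he t).hasDerivWithinAt.smul (hy t ht)
    refine h.congr_deriv ?_
    rw [smul_add, smul_smul, mul_neg, neg_smul]
    abel
  rw [NormedAddGroup.tendsto_nhds_zero] at hg
  rw [NormedAddGroup.tendsto_nhds_zero]
  intro ε hε
  -- The bound c ε / 2 on `g`, multiplied by exp(c s), integrates to at most (ε / 2) exp(c t);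
  -- dividing by ‖e t‖ = exp(c t) leaves ε / 2.
  obtain ⟨T, hT⟩ := eventually_atTop.1 (hg (c * (ε / 2)) (by positivity))
  obtain ⟨T, hT0, hT⟩ : ∃ T : ℝ, 0 ≤ T ∧ ∀ t, T ≤ t → ‖g t‖ < c * (ε / 2) :=
    ⟨max T 0, le_max_right _ _, fun t ht => hT t ((le_max_left _ _).trans ht)⟩
  have key : ∀ t, T ≤ t →
      ‖e t • y t‖ ≤ ‖e T • y T‖ + ε / 2 * (Real.exp (c * t) - Real.exp (c * T)) := by
    intro t ht
    have hB : ∀ s, HasDerivAt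
        (fun s => ‖e T • y T‖ + ε / 2 * (Real.exp (c * s) - Real.exp (c * T)))
        (ε / 2 * (Real.exp (c * s) * c)) s := fun s => by
      have h : HasDerivAt (fun s : ℝ => c * s) c s := by
        simpa using (hasDerivAt_id s).const_mul c
      exact ((h.exp.sub_const _).const_mul _).const_add _
    refine image_norm_le_of_norm_deriv_right_le_deriv_boundary (a := T) (b := t)
      (fun s hs => ((hh s (hT0.trans hs.1)).continuousWithinAt).mono
        (fun r hr => hT0.trans hr.1))
      (fun s hs => (hh s (hT0.trans hs.1)).mono (Set.Ici_subset_Ici.2 (hT0.trans hs.1)))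
      (by simp) hB (fun s hs => ?_) ⟨ht, le_rfl⟩
    rw [norm_smul, hen]
    have := mul_le_mul_of_nonneg_left (hT s hs.1).le (Real.exp_pos (c * s)).le
    linarith
  have hlim : Tendsto (fun t => Real.exp (-(c * t)) * ‖e T • y T‖) atTop (𝓝 0) := by
    have h : Tendsto (fun t => Real.exp (-(c * t))) atTop (𝓝 0) :=
      Real.tendsto_exp_neg_atTop_nhds_zero.comp (tendsto_id.const_mul_atTop hc)
    simpa using h.mul_const ‖e T • y T‖
  filter_upwards [eventually_ge_atTop T, hlim.eventually_lt_const (half_pos hε)] with t ht h1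
  have h2 := key t ht
  rw [norm_smul, hen] at h2
  have h3 : Real.exp (c * t) * Real.exp (-(c * t)) = 1 := by rw [← Real.exp_add]; simp
  have h4 : ‖y t‖ = Real.exp (-(c * t)) * (Real.exp (c * t) * ‖y t‖) := by
    rw [← mul_assoc, mul_comm (Real.exp _), h3, one_mul]
  have h5 := mul_le_mul_of_nonneg_left h2 (Real.exp_pos (-(c * t))).le
  have h6 := mul_pos (Real.exp_pos (-(c * t))) (Real.exp_pos (c * T))
  rw [h4]
  have h7 : Real.exp (-(c * t)) * (‖e T • y T‖ + ε / 2 * (Real.exp (c * t) - Real.exp (c * T)))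
      = Real.exp (-(c * t)) * ‖e T • y T‖ + ε / 2 * (Real.exp (c * t) * Real.exp (-(c * t)))
        - ε / 2 * (Real.exp (-(c * t)) * Real.exp (c * T)) := by ring
  rw [h7, h3] at h5
  have := mul_pos (half_pos hε) h6
  linarith

variable [FiniteDimensional ℂ E]

theorem tendsto_zero_apply (f : Module.End ℂ E) {y : ℝ → E} (hy : Tendsto y atTop (𝓝 0)) :
    Tendsto (fun t => f (y t)) atTop (𝓝 0) := by
  have h := (f.continuous_of_finiteDimensional.tendsto 0).comp hy
  rwa [map_zero] at h

theorem hasDerivWithinAt_apply (f : Module.End ℂ E) {y : ℝ → E} {y' : E} {s : Set ℝ} {t : ℝ}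
    (hy : HasDerivWithinAt y y' s t) : HasDerivWithinAt (fun t => f (y t)) (f y') s t :=
  ((LinearMap.toContinuousLinearMap f).restrictScalars ℝ).hasFDerivAt.comp_hasDerivWithinAt t hy

end StableODE

/-! ### Products of linear factors of an endomorphism -/

section RootProd

variable {E : Type*} [AddCommGroup E] [Module ℂ E]

/-- The monic polynomial with the given roots, evaluated at an endomorphism. -/
noncomputable def rootProd (f : Module.End ℂ E) (s : Multiset ℂ) : Module.End ℂ E :=
  Polynomial.aeval f (s.map fun μ => Polynomial.X - Polynomial.C μ).prod

theorem rootProd_zero (f : Module.End ℂ E) : rootProd f 0 = 1 := by simp [rootProd]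

theorem rootProd_cons_apply (f : Module.End ℂ E) (μ : ℂ) (s : Multiset ℂ) (v : E) :
    rootProd f (μ ::ₘ s) v = f (rootProd f s v) - μ • rootProd f s v := by
  simp [rootProd, Module.algebraMap_end_apply]

theorem rootProd_add (f : Module.End ℂ E) (s t : Multiset ℂ) :
    rootProd f (s + t) = rootProd f s * rootProd f t := by
  simp [rootProd]

theorem rootProd_replicate_zero (f : Module.End ℂ E) (k : ℕ) :
    rootProd f (Multiset.replicate k 0) = f ^ k := by
  simp [rootProd]

theorem commute_rootProd {f g : Module.End ℂ E} (h : Commute f g) (s : Multiset ℂ) :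
    Commute (rootProd f s) g := by
  induction s using Multiset.induction with
  | empty => simp [rootProd_zero]
  | cons μ s ih =>
    have : rootProd f (μ ::ₘ s) = (f - algebraMap ℂ _ μ) * rootProd f s := by simp [rootProd]
    rw [this]
    exact (h.sub_left (Algebra.commutes μ g)).mul_left ih

theorem rootProd_roots_minpoly [FiniteDimensional ℂ E] (f : Module.End ℂ E) :
    rootProd f (minpoly ℂ f).roots = 0 := by
  have h := (IsAlgClosed.splits (minpoly ℂ f)).eq_prod_roots
  rw [minpoly.monic (Algebra.IsIntegral.isIntegral f), map_one, one_mul] at h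
  rw [rootProd, ← h, minpoly.aeval]

theorem hasEigenvalue_of_mem_roots_minpoly [FiniteDimensional ℂ E] {f : Module.End ℂ E} {μ : ℂ}
    (h : μ ∈ (minpoly ℂ f).roots) : f.HasEigenvalue μ :=
  Module.End.hasEigenvalue_of_isRoot (Polynomial.isRoot_of_mem_roots h)

/-- If `0` is a semisimple eigenvalue of `f` or no eigenvalue at all, then `f` is annihilated by
`X` times the product over the nonzero roots of its minimal polynomial. -/
theorem apply_rootProd_filter_eq_zero [FiniteDimensional ℂ E] {f : Module.End ℂ E}
    (h0 : ∀ v, f (f v) = 0 → f v = 0) (v : E) :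
    rootProd f ((minpoly ℂ f).roots.filter (· ≠ 0)) (f v) = 0 := by
  set s := (minpoly ℂ f).roots with hs
  have hpow : ∀ (k : ℕ) (v : E), (f ^ k) v = 0 → f v = 0 := by
    intro k
    induction k with
    | zero => intro v hv; simp_all
    | succ k ih =>
      intro v hv
      rw [pow_succ] at hv
      exact h0 v (ih (f v) hv)
  have h1 : s.filter (· = 0) + s.filter (fun x => ¬ x = 0) = s := Multiset.filter_add_not _ s
  have h2 : rootProd f s v = 0 := by rw [hs, rootProd_roots_minpoly]; rfl
  -- The zero roots contribute a power of `f`, which `hpow` reduces to a single factor.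
  rw [← h1, rootProd_add, Multiset.filter_eq', rootProd_replicate_zero] at h2
  have h3 := hpow _ _ h2
  have hc := (commute_rootProd (Commute.refl f) (s.filter (· ≠ 0))).eq
  rw [← Module.End.mul_apply, hc]
  exact h3

end RootProd

/-! ### Decay of the disagreement -/

section Synchronization

variable {E : Type*} [NormedAddCommGroup E] [NormedSpace ℂ E] [FiniteDimensional ℂ E]

/-- Trajectories of a Hurwitz linear system with a vanishing input vanish. -/
theorem tendsto_zero_of_hurwitz {f : Module.End ℂ E}
    (hf : ∀ μ, f.HasEigenvalue μ → μ.re < 0) {y g : ℝ → E}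
    (hy : ∀ t : ℝ, 0 ≤ t → HasDerivWithinAt y (f (y t) + g t) (Set.Ici 0) t)
    (hg : Tendsto g atTop (𝓝 0)) : Tendsto y atTop (𝓝 0) := by
  -- One root is peeled off at a time: p_s(f) y solves a scalar equation with rate μ, whose input
  -- contains p_{μ, s}(f) y, already known to vanish.
  have key : ∀ s : Multiset ℂ, (∀ μ ∈ s, μ.re < 0) →
      Tendsto (fun t => rootProd f s (y t)) atTop (𝓝 0) → Tendsto y atTop (𝓝 0) := by
    intro s
    induction s using Multiset.induction with
    | empty => intro _ h; simpa [rootProd_zero] using h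
    | cons μ s ih =>
      intro hs h
      refine ih (fun ν hν => hs ν (Multiset.mem_cons_of_mem hν)) ?_
      refine tendsto_zero_of_hasDerivWithinAt_smul_add (hs μ (Multiset.mem_cons_self μ s))
        (g := fun t => rootProd f (μ ::ₘ s) (y t) + rootProd f s (g t)) (fun t ht => ?_) ?_
      · refine (hasDerivWithinAt_apply (rootProd f s) (hy t ht)).congr_deriv ?_
        have hc := LinearMap.congr_fun (commute_rootProd (Commute.refl f) s).eq (y t)
        simp only [Module.End.mul_apply] at hc
        rw [map_add, hc, rootProd_cons_apply]
        abel
      · simpa using h.add (tendsto_zero_apply (rootProd f s) hg)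
  refine key _ (fun μ hμ => hf μ (hasEigenvalue_of_mem_roots_minpoly hμ)) ?_
  simp [rootProd_roots_minpoly]

/-- In the coupled system `x' = a x - b l x`, where the coupling operator `l` commutes with `a` and
`b`, the disagreement `l x` vanishes if `0` is at worst a semisimple eigenvalue of `l` and
`a - ν b` is Hurwitz for all other eigenvalues `ν` of `l`. -/
theorem tendsto_coupling_zero {a b l : Module.End ℂ E} (ha : Commute l a) (hb : Commute l b)
    (hl : ∀ v, l (l v) = 0 → l v = 0)
    (hab : ∀ ν, l.HasEigenvalue ν → ν ≠ 0 → ∀ μ, (a - ν • b).HasEigenvalue μ → μ.re < 0)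
    {x : ℝ → E}
    (hx : ∀ t : ℝ, 0 ≤ t → HasDerivWithinAt x (a (x t) - b (l (x t))) (Set.Ici 0) t) :
    Tendsto (fun t => l (x t)) atTop (𝓝 0) := by
  have hd : ∀ p : Module.End ℂ E, Commute p a → Commute p b → Commute p l → ∀ t : ℝ, 0 ≤ t →
      HasDerivWithinAt (fun t => p (x t)) (a (p (x t)) - b (l (p (x t)))) (Set.Ici 0) t := by
    intro p hpa hpb hpl t ht
    refine (hasDerivWithinAt_apply p (hx t ht)).congr_deriv ?_
    have h1 := LinearMap.congr_fun hpa.eq (x t)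
    have h2 := LinearMap.congr_fun hpb.eq (l (x t))
    have h3 := LinearMap.congr_fun hpl.eq (x t)
    simp only [Module.End.mul_apply] at h1 h2 h3
    rw [map_sub, h1, h2, h3]
  -- The same peeling, now along the spectrum of `l`: for z = p_s(l) l x, writing l z = ν z + p_{ν,
  -- s}(l) l x gives z' = (a - ν b) z plus a vanishing input.
  have key : ∀ s : Multiset ℂ, (∀ ν ∈ s, l.HasEigenvalue ν ∧ ν ≠ 0) →
      Tendsto (fun t => rootProd l s (l (x t))) atTop (𝓝 0) →
      Tendsto (fun t => l (x t)) atTop (𝓝 0) := by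
    intro s
    induction s using Multiset.induction with
    | empty => intro _ h; simpa [rootProd_zero] using h
    | cons ν s ih =>
      intro hs h
      refine ih (fun ν hν => hs ν (Multiset.mem_cons_of_mem hν)) ?_
      obtain ⟨h1, h2⟩ := hs ν (Multiset.mem_cons_self ν s)
      refine tendsto_zero_of_hurwitz (f := a - ν • b) (hab ν h1 h2)
        (g := fun t => -b (rootProd l (ν ::ₘ s) (l (x t)))) (fun t ht => ?_) ?_
      · refine (hd (rootProd l s * l) ((commute_rootProd ha s).mul_left ha)
          ((commute_rootProd hb s).mul_left hb)
          ((commute_rootProd (Commute.refl l) s).mul_left (Commute.refl l)) t ht).congr_deriv ?_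
        simp only [Module.End.mul_apply, rootProd_cons_apply, LinearMap.sub_apply,
          LinearMap.smul_apply, map_sub, map_smul]
        abel
      · simpa using (tendsto_zero_apply b h).neg
  -- The extra factor `l` takes care of the eigenvalue 0, so no stability of `a` itself is needed.
  refine key ((minpoly ℂ l).roots.filter (· ≠ 0)) (fun ν hν => ?_) ?_
  · rw [Multiset.mem_filter] at hν
    exact ⟨hasEigenvalue_of_mem_roots_minpoly hν.1, hν.2⟩
  · simp [apply_rootProd_filter_eq_zero hl]

/-- A linear map that vanishes on the kernel of `l` vanishes in the limit where `l` does. -/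
theorem tendsto_zero_of_ker_le {F : Type*} [AddCommGroup F] [Module ℂ F] [TopologicalSpace F]
    [IsTopologicalAddGroup F] [ContinuousSMul ℂ F] {l : Module.End ℂ E} {d : E →ₗ[ℂ] F}
    (h : ∀ v, l v = 0 → d v = 0) {x : ℝ → E} (hx : Tendsto (fun t => l (x t)) atTop (𝓝 0)) :
    Tendsto (fun t => d (x t)) atTop (𝓝 0) := by
  -- `d` descends to the range of `l` and extends from there to `E`, so `d = k ∘ l`.
  obtain ⟨k, hk⟩ := LinearMap.exists_extend
    (((LinearMap.ker l).liftQ d h).comp l.quotKerEquivRange.symm.toLinearMap)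
  have hk' : ∀ v, k (l v) = d v := fun v => by
    have h1 := LinearMap.congr_fun hk (l.rangeRestrict v)
    have h2 : l.quotKerEquivRange.symm (l.rangeRestrict v) = Submodule.Quotient.mk v := by
      rw [LinearEquiv.symm_apply_eq]; rfl
    simp only [LinearMap.comp_apply, LinearEquiv.coe_coe, h2] at h1
    exact h1
  have h1 := (k.continuous_of_finiteDimensional.tendsto 0).comp hx
  rw [map_zero] at h1
  exact h1.congr fun t => hk' (x t)

end Synchronization

/-! ### Real matrices on complex vectors -/

section Complexification

variable {ι κ : Type*} [Fintype ι]

theorem map_ofReal_mulVec_re (M : Matrix κ ι ℝ) (v : ι → ℂ) (i : κ) :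
    ((M.map Complex.ofReal *ᵥ v) i).re = (M *ᵥ fun j => (v j).re) i := by
  simp [Matrix.mulVec, dotProduct]

theorem map_ofReal_mulVec_im (M : Matrix κ ι ℝ) (v : ι → ℂ) (i : κ) :
    ((M.map Complex.ofReal *ᵥ v) i).im = (M *ᵥ fun j => (v j).im) i := by
  simp [Matrix.mulVec, dotProduct]

theorem map_ofReal_mulVec_eq_zero_iff (M : Matrix κ ι ℝ) (v : ι → ℂ) :
    M.map Complex.ofReal *ᵥ v = 0 ↔
      M *ᵥ (fun j => (v j).re) = 0 ∧ M *ᵥ (fun j => (v j).im) = 0 := by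
  simp only [funext_iff, Complex.ext_iff, map_ofReal_mulVec_re, map_ofReal_mulVec_im,
    Pi.zero_apply, Complex.zero_re, Complex.zero_im, forall_and]

theorem star_dotProduct_map_ofReal_re (M : Matrix ι ι ℝ) (v : ι → ℂ) :
    (star v ⬝ᵥ (M.map Complex.ofReal *ᵥ v)).re =
      (fun j => (v j).re) ⬝ᵥ (M *ᵥ fun j => (v j).re) +
        (fun j => (v j).im) ⬝ᵥ (M *ᵥ fun j => (v j).im) := by
  simp [dotProduct, map_ofReal_mulVec_re, map_ofReal_mulVec_im, Finset.sum_add_distrib]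

end Complexification

/-! ### Kernel and spectrum of a Laplacian -/

section Laplacian

variable {ι : Type*} [Fintype ι]

/-- A Laplacian of a directed graph with nonnegative weights `-M i j`. -/
structure IsLaplacian (M : Matrix ι ι ℝ) : Prop where
  nonpos : ∀ i j, i ≠ j → M i j ≤ 0
  row_sum : ∀ i, ∑ j, M i j = 0

/-- There is an arc from `i` to `j` if the weight `-M j i` is positive. -/
def HasArc (M : Matrix ι ι ℝ) (i j : ι) : Prop := i ≠ j ∧ M j i < 0

namespace IsLaplacian

variable {M : Matrix ι ι ℝ}

theorem mulVec_eq (hM : IsLaplacian M) (v : ι → ℝ) (i : ι) :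
    (M *ᵥ v) i = ∑ j, -M i j * (v i - v j) := by
  simp only [Matrix.mulVec, dotProduct, mul_sub, Finset.sum_sub_distrib, ← Finset.sum_mul,
    Finset.sum_neg_distrib, hM.row_sum, neg_mul]
  simp

variable [DecidableEq ι]

theorem term_nonneg (hM : IsLaplacian M) {v : ι → ℝ} {i : ι} (hi : ∀ j, v j ≤ v i) (j : ι) :
    0 ≤ -M i j * (v i - v j) := by
  by_cases h : i = j
  · simp [h]
  · exact mul_nonneg (neg_nonneg.2 (hM.nonpos i j h)) (sub_nonneg.2 (hi j))

theorem mulVec_nonneg_of_max (hM : IsLaplacian M) {v : ι → ℝ} {i : ι} (hi : ∀ j, v j ≤ v i) :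
    0 ≤ (M *ᵥ v) i := by
  rw [hM.mulVec_eq]
  exact Finset.sum_nonneg fun j _ => hM.term_nonneg hi j

/-- Maximum principle: at a maximum of `v` all terms of the row are nonnegative, so a zero sum
forces equality across each positive weight. -/
theorem eq_of_hasArc_of_max (hM : IsLaplacian M) {v : ι → ℝ} {i j : ι} (hi : ∀ j, v j ≤ v i)
    (h0 : (M *ᵥ v) i = 0) (h : HasArc M j i) : v j = v i := by
  rw [hM.mulVec_eq, Finset.sum_eq_zero_iff_of_nonneg fun j _ => hM.term_nonneg hi j] at h0
  have h1 := h0 j (Finset.mem_univ j)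
  have h2 := h.2
  rcases mul_eq_zero.1 h1 with h3 | h3 <;> linarith

theorem le_root_of_mulVec_eq_zero (hM : IsLaplacian M) {r : ι}
    (hr : ∀ i, Relation.ReflTransGen (HasArc M) r i) {v : ι → ℝ} (h0 : M *ᵥ v = 0) (i : ι) :
    v i ≤ v r := by
  have : Nonempty ι := ⟨r⟩
  obtain ⟨m, hm⟩ := Finite.exists_max v
  suffices h : ∀ k, Relation.ReflTransGen (HasArc M) k m → v k = v m by
    rw [h r (hr m)]; exact hm i
  intro k hk
  induction hk using Relation.ReflTransGen.head_induction_on with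
  | refl => rfl
  | head h _ ih =>
    rw [← ih]
    exact hM.eq_of_hasArc_of_max (fun j => ih ▸ hm j) (congrFun h0 _) h

/-- If some vertex reaches all others, the kernel of the Laplacian consists of the consensus
vectors. -/
theorem eq_of_mulVec_eq_zero (hM : IsLaplacian M) {r : ι}
    (hr : ∀ i, Relation.ReflTransGen (HasArc M) r i) {v : ι → ℝ} (h0 : M *ᵥ v = 0) (i j : ι) :
    v i = v j := by
  have h : ∀ i, v i = v r := fun i => by
    have h1 := hM.le_root_of_mulVec_eq_zero hr h0 i
    have h2 := hM.le_root_of_mulVec_eq_zero hr (v := -v) (by rw [Matrix.mulVec_neg, h0, neg_zero]) i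
    simp only [Pi.neg_apply] at h2
    linarith
  rw [h i, h j]

/-- There is no Jordan block at 0: `M v` is constant, nonnegative where `v` is maximal and
nonpositive where `v` is minimal. -/
theorem mulVec_eq_zero_of_mulVec_mulVec (hM : IsLaplacian M) {r : ι}
    (hr : ∀ i, Relation.ReflTransGen (HasArc M) r i) {v : ι → ℝ} (h0 : M *ᵥ (M *ᵥ v) = 0) :
    M *ᵥ v = 0 := by
  have : Nonempty ι := ⟨r⟩
  have hc := hM.eq_of_mulVec_eq_zero hr h0
  obtain ⟨a, ha⟩ := Finite.exists_max v
  obtain ⟨b, hb⟩ := Finite.exists_max (-v)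
  have h1 := hM.mulVec_nonneg_of_max ha
  have h2 := hM.mulVec_nonneg_of_max hb
  rw [Matrix.mulVec_neg, Pi.neg_apply] at h2
  ext i
  have h3 := hc i a
  have h4 := hc i b
  rw [Pi.zero_apply]
  linarith

theorem diag_eq (hM : IsLaplacian M) (k : ι) : ∑ j ∈ Finset.univ.erase k, |M k j| = M k k := by
  have h1 := Finset.sum_erase_add Finset.univ (M k) (Finset.mem_univ k)
  rw [hM.row_sum] at h1
  rw [Finset.sum_congr rfl fun j hj =>
    abs_of_nonpos (hM.nonpos k j (Finset.ne_of_mem_erase hj).symm), Finset.sum_neg_distrib]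
  linarith

/-- Each Gershgorin disc has centre and radius `M k k`, so it meets the closed left half-plane only
at 0. -/
theorem re_pos_of_mulVec_eq_smul (hM : IsLaplacian M) {ν : ℂ} {v : ι → ℂ} (hv : v ≠ 0)
    (h : M.map Complex.ofReal *ᵥ v = ν • v) (hν : ν ≠ 0) : 0 < ν.re := by
  have he : Module.End.HasEigenvalue (Matrix.toLin' (M.map Complex.ofReal)) ν :=
    Module.End.hasEigenvalue_of_hasEigenvector
      (Module.End.hasEigenvector_iff.2 ⟨Module.End.mem_eigenspace_iff.2 (by simpa using h), hv⟩)
  obtain ⟨k, hk⟩ := eigenvalue_mem_ball he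
  simp only [Matrix.map_apply, Complex.norm_real, Real.norm_eq_abs, hM.diag_eq,
    Metric.mem_closedBall, dist_eq_norm] at hk
  have hd : 0 ≤ M k k := (norm_nonneg _).trans hk
  have h2 : Complex.normSq (ν - M k k) ≤ M k k ^ 2 := by
    rw [Complex.normSq_eq_norm_sq]; gcongr
  simp only [Complex.normSq_apply, Complex.sub_re, Complex.sub_im, Complex.ofReal_re,
    Complex.ofReal_im, sub_zero] at h2
  by_contra! hre
  refine hν (Complex.normSq_eq_zero.1 ?_)
  rw [Complex.normSq_apply]
  nlinarith [mul_nonneg hd (neg_nonneg.2 hre), mul_self_nonneg ν.re, mul_self_nonneg ν.im]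

theorem map_eq_of_mulVec_eq_zero (hM : IsLaplacian M) {r : ι}
    (hr : ∀ i, Relation.ReflTransGen (HasArc M) r i) {v : ι → ℂ}
    (h0 : M.map Complex.ofReal *ᵥ v = 0) (i j : ι) : v i = v j := by
  rw [map_ofReal_mulVec_eq_zero_iff] at h0
  exact Complex.ext (hM.eq_of_mulVec_eq_zero hr h0.1 i j) (hM.eq_of_mulVec_eq_zero hr h0.2 i j)

theorem map_mulVec_eq_zero_of_mulVec_mulVec (hM : IsLaplacian M)
    {r : ι} (hr : ∀ i, Relation.ReflTransGen (HasArc M) r i) {v : ι → ℂ}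
    (h0 : M.map Complex.ofReal *ᵥ (M.map Complex.ofReal *ᵥ v) = 0) :
    M.map Complex.ofReal *ᵥ v = 0 := by
  simp only [map_ofReal_mulVec_eq_zero_iff, map_ofReal_mulVec_re, map_ofReal_mulVec_im] at h0 ⊢
  exact ⟨hM.mulVec_eq_zero_of_mulVec_mulVec hr h0.1, hM.mulVec_eq_zero_of_mulVec_mulVec hr h0.2⟩

end IsLaplacian

end Laplacian

/-! ### Quadratic forms and output feedback -/

section Complexification

variable {ι κ l : Type*} [Fintype ι]

theorem map_ofReal_mul (M : Matrix κ ι ℝ) (N : Matrix ι l ℝ) :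
    (M * N).map Complex.ofReal = M.map Complex.ofReal * N.map Complex.ofReal :=
  Matrix.map_mul (f := Complex.ofRealHom)

theorem map_ofReal_mul_mulVec [Fintype l] (M : Matrix κ ι ℝ) (N : Matrix ι l ℝ) (v : l → ℂ) :
    (M * N).map Complex.ofReal *ᵥ v = M.map Complex.ofReal *ᵥ (N.map Complex.ofReal *ᵥ v) := by
  rw [map_ofReal_mul, Matrix.mulVec_mulVec]

theorem map_ofReal_pow_mulVec [DecidableEq ι] (M : Matrix ι ι ℝ) {μ : ℂ} {v : ι → ℂ}
    (h : M.map Complex.ofReal *ᵥ v = μ • v) (k : ℕ) :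
    (M ^ k).map Complex.ofReal *ᵥ v = μ ^ k • v := by
  induction k with
  | zero => simp [Matrix.map_one]
  | succ k ih =>
    rw [pow_succ, map_ofReal_mul_mulVec, h, Matrix.mulVec_smul, ih, smul_smul, pow_succ, mul_comm]

theorem star_dotProduct_map_ofReal_im {M : Matrix ι ι ℝ} (hM : Mᵀ = M) (v : ι → ℂ) :
    (star v ⬝ᵥ (M.map Complex.ofReal *ᵥ v)).im = 0 := by
  have h : (star v ⬝ᵥ (M.map Complex.ofReal *ᵥ v)).im =
      (fun j => (v j).re) ⬝ᵥ (M *ᵥ fun j => (v j).im) -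
        (fun j => (v j).im) ⬝ᵥ (M *ᵥ fun j => (v j).re) := by
    simp [dotProduct, map_ofReal_mulVec_re, map_ofReal_mulVec_im, Finset.sum_add_distrib,
      sub_eq_add_neg]
  rw [h, Matrix.dotProduct_mulVec, ← Matrix.mulVec_transpose, hM, dotProduct_comm, sub_self]

end Complexification

theorem dotProduct_mulVec_eq_zero_of_skew {ι : Type*} [Fintype ι] {M : Matrix ι ι ℝ}
    (hM : Mᵀ = -M) (v : ι → ℝ) : v ⬝ᵥ (M *ᵥ v) = 0 := by
  have h : v ⬝ᵥ (M *ᵥ v) = -(v ⬝ᵥ (M *ᵥ v)) := by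
    conv_lhs => rw [Matrix.dotProduct_mulVec, ← Matrix.mulVec_transpose, hM, dotProduct_comm,
      Matrix.neg_mulVec, dotProduct_neg]
  linarith

theorem dotProduct_mul_transpose_mulVec {ι κ : Type*} [Fintype ι] [Fintype κ] (M : Matrix ι κ ℝ)
    (v : ι → ℝ) : v ⬝ᵥ ((M * Mᵀ) *ᵥ v) = (Mᵀ *ᵥ v) ⬝ᵥ (Mᵀ *ᵥ v) := by
  rw [← Matrix.mulVec_mulVec, Matrix.dotProduct_mulVec, Matrix.mulVec_transpose]

namespace PortHamiltonian

variable {n m : ℕ}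

/-- Hautus test: C Aᵏ v = μᵏ C v = 0, so the real and imaginary parts of `v` are unobservable. -/
theorem eq_zero_of_isObservable {P : PortHamiltonian n m} (h : P.toLinearSystem.IsObservable)
    {μ : ℂ} {v : Fin n → ℂ} (hA : P.A.map Complex.ofReal *ᵥ v = μ • v)
    (hC : P.C.map Complex.ofReal *ᵥ v = 0) : v = 0 := by
  have hk : ∀ k : ℕ, (P.C * P.A ^ k).map Complex.ofReal *ᵥ v = 0 := fun k => by
    rw [map_ofReal_mul_mulVec, map_ofReal_pow_mulVec _ hA, Matrix.mulVec_smul, hC, smul_zero]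
  have h0 : ∀ x : Fin n → ℝ, (∀ k : ℕ, (P.C * P.A ^ k) *ᵥ x = 0) → x = 0 := fun x hx => by
    have : x ∈ (⨅ k : ℕ, LinearMap.ker
        (P.toLinearSystem.C * P.toLinearSystem.A ^ k).mulVecLin) := by
      rw [Submodule.mem_iInf]
      exact fun k => LinearMap.mem_ker.2 (hx k)
    rw [h] at this
    exact (Submodule.mem_bot ℝ).1 this
  have hre := h0 _ fun k => ((map_ofReal_mulVec_eq_zero_iff _ _).1 (hk k)).1
  have him := h0 _ fun k => ((map_ofReal_mulVec_eq_zero_iff _ _).1 (hk k)).2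
  ext i
  exact Complex.ext (congrFun hre i) (congrFun him i)

/-- Output feedback with a gain of positive real part stabilizes an observable port-Hamiltonian
system. -/
theorem re_neg_of_feedback_eigenvector {P : PortHamiltonian n m}
    (h : P.toLinearSystem.IsObservable) {μ ν : ℂ} (hν : 0 < ν.re) {v : Fin n → ℂ} (hv : v ≠ 0)
    (he : P.A.map Complex.ofReal *ᵥ v - ν • ((P.B * P.C).map Complex.ofReal *ᵥ v) = μ • v) :
    μ.re < 0 := by
  have hQ : P.Qᵀ = P.Q := by simpa using P.Q_posDef.isHermitian.eq
  have hR : ∀ x : Fin n → ℝ, 0 ≤ x ⬝ᵥ (P.R *ᵥ x) := fun x => by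
    simpa using P.R_posSemidef.dotProduct_mulVec_nonneg x
  have hQ0 : ∀ x : Fin n → ℝ, 0 ≤ x ⬝ᵥ (P.Q *ᵥ x) := fun x => by
    simpa using P.Q_posDef.posSemidef.dotProduct_mulVec_nonneg x
  have hQ1 : ∀ x : Fin n → ℝ, x ≠ 0 → 0 < x ⬝ᵥ (P.Q *ᵥ x) := fun x hx => by
    simpa using P.Q_posDef.dotProduct_mulVec_pos hx
  set z : Fin n → ℂ := P.Q.map Complex.ofReal *ᵥ v with hz
  have hA : P.A.map Complex.ofReal *ᵥ v = (P.J - P.R).map Complex.ofReal *ᵥ z :=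
    map_ofReal_mul_mulVec _ _ _
  have hBC : (P.B * P.C).map Complex.ofReal *ᵥ v = (P.B * P.Bᵀ).map Complex.ofReal *ᵥ z := by
    rw [PortHamiltonian.C, ← Matrix.mul_assoc, map_ofReal_mul_mulVec]
  have hC : P.C.map Complex.ofReal *ᵥ v = P.Bᵀ.map Complex.ofReal *ᵥ z :=
    map_ofReal_mul_mulVec _ _ _
  have hqim : (star z ⬝ᵥ v).im = 0 := by
    rw [Matrix.star_dotProduct, Complex.star_def, Complex.conj_im,
      star_dotProduct_map_ofReal_im hQ, neg_zero]
  have hqre : 0 < (star z ⬝ᵥ v).re := by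
    rw [Matrix.star_dotProduct, Complex.star_def, Complex.conj_re, star_dotProduct_map_ofReal_re]
    by_cases h1 : (fun j => (v j).re) = 0
    · have h2 : (fun j => (v j).im) ≠ 0 := fun h2 =>
        hv (funext fun i => Complex.ext (congrFun h1 i) (congrFun h2 i))
      exact add_pos_of_nonneg_of_pos (hQ0 _) (hQ1 _ h2)
    · exact add_pos_of_pos_of_nonneg (hQ1 _ h1) (hQ0 _)
  have hpim : (star z ⬝ᵥ ((P.B * P.Bᵀ).map Complex.ofReal *ᵥ z)).im = 0 :=
    star_dotProduct_map_ofReal_im (by simp) z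
  have hpre := star_dotProduct_map_ofReal_re (P.B * P.Bᵀ) z
  rw [dotProduct_mul_transpose_mulVec, dotProduct_mul_transpose_mulVec] at hpre
  have hJR : (star z ⬝ᵥ ((P.J - P.R).map Complex.ofReal *ᵥ z)).re ≤ 0 := by
    rw [star_dotProduct_map_ofReal_re, Matrix.sub_mulVec, Matrix.sub_mulVec, dotProduct_sub,
      dotProduct_sub, dotProduct_mulVec_eq_zero_of_skew P.J_skew,
      dotProduct_mulVec_eq_zero_of_skew P.J_skew]
    linarith [hR fun j => (z j).re, hR fun j => (z j).im]
  -- Energy balance, from pairing with z = Q v: Re(z* (J - R) z) - Re ν · |Bᵀ z|² = Re μ · v* Q v.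
  have heq := congrArg Complex.re (congrArg (star z ⬝ᵥ ·) he)
  simp only [hA, hBC, dotProduct_sub, dotProduct_smul, smul_eq_mul, Complex.sub_re,
    Complex.mul_re, hpim, hqim, mul_zero, sub_zero] at heq
  set p := (star z ⬝ᵥ ((P.B * P.Bᵀ).map Complex.ofReal *ᵥ z)).re
  -- If Re μ ≥ 0, the balance forces Bᵀ z = C v = 0; the feedback drops out and `v` is an
  -- unobservable eigenvector of `A`.
  by_contra! hμ
  have hp : p ≤ 0 := by
    by_contra! hp
    linarith [mul_pos hν hp, mul_nonneg hμ hqre.le]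
  have h1 : 0 ≤ (P.Bᵀ *ᵥ fun j => (z j).re) ⬝ᵥ (P.Bᵀ *ᵥ fun j => (z j).re) :=
    Finset.sum_nonneg fun i _ => mul_self_nonneg _
  have h2 : 0 ≤ (P.Bᵀ *ᵥ fun j => (z j).im) ⬝ᵥ (P.Bᵀ *ᵥ fun j => (z j).im) :=
    Finset.sum_nonneg fun i _ => mul_self_nonneg _
  have hCv : P.C.map Complex.ofReal *ᵥ v = 0 := by
    rw [hC, map_ofReal_mulVec_eq_zero_iff]
    exact ⟨dotProduct_self_eq_zero.1 (by linarith), dotProduct_self_eq_zero.1 (by linarith)⟩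
  refine hv (eq_zero_of_isObservable h (μ := μ) ?_ hCv)
  rw [← he, map_ofReal_mul_mulVec, hCv, Matrix.mulVec_zero, smul_zero, sub_zero]

end PortHamiltonian

/-! ### Synchronization of the Kronecker-coupled system -/

section Kronecker

variable {ι κ R : Type*} [Fintype ι] [Fintype κ] [CommRing R]

theorem one_kronecker_mulVec [DecidableEq ι] (A : Matrix κ κ R) (v : ι × κ → R) (i : ι) :
    (fun c => (((1 : Matrix ι ι R) ⊗ₖ A) *ᵥ v) (i, c)) = A *ᵥ fun d => v (i, d) := by
  ext c
  simp [Matrix.mulVec, dotProduct, Fintype.sum_prod_type, Matrix.one_apply]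

theorem kronecker_one_mulVec [DecidableEq κ] (L : Matrix ι ι R) (v : ι × κ → R) (c : κ) :
    (fun i => ((L ⊗ₖ (1 : Matrix κ κ R)) *ᵥ v) (i, c)) = L *ᵥ fun j => v (j, c) := by
  ext i
  simp [Matrix.mulVec, dotProduct, Fintype.sum_prod_type, Matrix.one_apply]

theorem commute_kronecker_one [DecidableEq ι] [DecidableEq κ] (L : Matrix ι ι R)
    (A : Matrix κ κ R) :
    Commute (Matrix.toLin' (L ⊗ₖ (1 : Matrix κ κ R)))
      (Matrix.toLin' ((1 : Matrix ι ι R) ⊗ₖ A)) := by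
  rw [commute_iff_eq, Module.End.mul_eq_comp, Module.End.mul_eq_comp, ← Matrix.toLin'_mul,
    ← Matrix.toLin'_mul, ← Matrix.mul_kronecker_mul, ← Matrix.mul_kronecker_mul]
  simp

end Kronecker

/-- Port-Hamiltonian systems coupled by a Laplacian synchronize if some vertex reaches all
others. -/
theorem tendsto_sub_of_isLaplacian {n m q r s : ℕ} {P : PortHamiltonian n m}
    (hP : P.toLinearSystem.IsObservable) {L : Matrix (Fin q) (Fin q) ℝ} (hL : IsLaplacian L)
    {ρ : Fin q} (hρ : ∀ i, Relation.ReflTransGen (HasArc L) ρ i)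
    {G : Matrix (Fin q) (Fin r) ℝ} {H : Matrix (Fin s) (Fin q) ℝ} {x : ℝ → Fin q × Fin n → ℝ}
    (hx : (coupledSystem P L G H).IsTrajectory 0 x) (i j : Fin q) :
    Tendsto (fun t : ℝ => (fun a : Fin n => x t (i, a)) - fun a : Fin n => x t (j, a))
      atTop (𝓝 0) := by
  let z : ℝ → Fin q × Fin n → ℂ := fun t p => x t p
  let a := Matrix.toLin' ((1 : Matrix (Fin q) (Fin q) ℂ) ⊗ₖ P.A.map Complex.ofReal)
  let b := Matrix.toLin' ((1 : Matrix (Fin q) (Fin q) ℂ) ⊗ₖ (P.B * P.C).map Complex.ofReal)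
  let l := Matrix.toLin' (L.map Complex.ofReal ⊗ₖ (1 : Matrix (Fin n) (Fin n) ℂ))
  have hl : ∀ v c, (fun i => l v (i, c)) = L.map Complex.ofReal *ᵥ fun j => v (j, c) :=
    fun v c => kronecker_one_mulVec _ v c
  have ha : ∀ v i, (fun c => a v (i, c)) = P.A.map Complex.ofReal *ᵥ fun d => v (i, d) :=
    fun v i => one_kronecker_mulVec _ v i
  have hb : ∀ v i, (fun c => b v (i, c)) =
      (P.B * P.C).map Complex.ofReal *ᵥ fun d => v (i, d) :=
    fun v i => one_kronecker_mulVec _ v i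
  have hz : ∀ t : ℝ, 0 ≤ t → HasDerivWithinAt z (a (z t) - b (l (z t))) (Set.Ici 0) t := by
    intro t ht
    have h1 := hx t ht
    rw [hasDerivWithinAt_pi] at h1 ⊢
    intro p
    refine (h1 p).ofReal_comp.congr_deriv ?_
    have h2 : (coupledSystem P L G H).A =
        (1 : Matrix (Fin q) (Fin q) ℝ) ⊗ₖ P.A -
          ((1 : Matrix (Fin q) (Fin q) ℝ) ⊗ₖ (P.B * P.C)) *
            (L ⊗ₖ (1 : Matrix (Fin n) (Fin n) ℝ)) := by
      rw [← Matrix.mul_kronecker_mul, Matrix.one_mul, Matrix.mul_one]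
      rfl
    obtain ⟨i, c⟩ := p
    have h3 : a (z t) (i, c) = _ := congrFun (ha (z t) i) c
    have h4 : b (l (z t)) (i, c) = _ := congrFun (hb (l (z t)) i) c
    have h5 : ∀ d, l (z t) (i, d) = _ := fun d => congrFun (hl (z t) d) i
    rw [h2, Pi.sub_apply, h3, h4, Matrix.sub_mulVec, ← Matrix.mulVec_mulVec]
    have h6 := congrFun (one_kronecker_mulVec P.A (x t) i) c
    have h7 := congrFun (one_kronecker_mulVec (P.B * P.C)
      ((L ⊗ₖ (1 : Matrix (Fin n) (Fin n) ℝ)) *ᵥ x t) i) c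
    have h8 : ∀ d, _ = _ := fun d => congrFun (kronecker_one_mulVec L (x t) d) i
    simp only [Pi.add_apply, Pi.sub_apply, Pi.zero_apply, Matrix.mulVec_zero, add_zero, h6, h7,
      h5, h8]
    simp [Matrix.mulVec, dotProduct, z]
  have hlz : Tendsto (fun t => l (z t)) atTop (𝓝 0) := by
    refine tendsto_coupling_zero (commute_kronecker_one _ _) (commute_kronecker_one _ _)
      (fun v hv => ?_) (fun ν hν hν0 μ hμ => ?_) hz
    · ext ⟨i, c⟩
      suffices h : (fun i => l v (i, c)) = 0 from congrFun h i
      rw [hl]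
      refine hL.map_mulVec_eq_zero_of_mulVec_mulVec hρ ?_
      rw [← hl, ← hl]
      exact funext fun i => congrFun hv (i, c)
    · obtain ⟨v, hv⟩ := hν.exists_hasEigenvector
      obtain ⟨w, hw⟩ := hμ.exists_hasEigenvector
      have hν1 : 0 < ν.re := by
        -- A nonzero slice of an eigenvector over a fixed state coordinate is an eigenvector of `L`;
        -- below, a slice over a fixed vertex plays this role for `A - ν B C`.
        obtain ⟨⟨i, c⟩, hic⟩ := Function.ne_iff.1 hv.2
        refine hL.re_pos_of_mulVec_eq_smul (v := fun j => v (j, c))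
          (fun h => hic (congrFun h i)) ?_ hν0
        rw [← hl]
        exact funext fun j => congrFun hv.apply_eq_smul (j, c)
      obtain ⟨⟨i, c⟩, hic⟩ := Function.ne_iff.1 hw.2
      refine PortHamiltonian.re_neg_of_feedback_eigenvector hP hν1 (v := fun d => w (i, d))
        (fun h => hic (congrFun h c)) ?_
      rw [← ha, ← hb]
      exact funext fun d => congrFun hw.apply_eq_smul (i, d)
  rw [tendsto_pi_nhds]
  intro c
  have hd := tendsto_zero_of_ker_le (l := l)
    (d := LinearMap.proj (i, c) - LinearMap.proj (R := ℂ) (φ := fun _ => ℂ) (j, c))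
    (fun v hv => ?_) hlz
  · have h1 := (Complex.continuous_re.tendsto 0).comp hd
    rw [Complex.zero_re] at h1
    refine h1.congr fun t => ?_
    simp [z]
  · rw [LinearMap.sub_apply, LinearMap.proj_apply, LinearMap.proj_apply, sub_eq_zero]
    refine hL.map_eq_of_mulVec_eq_zero hρ (v := fun i => v (i, c)) ?_ i j
    rw [← hl]
    exact funext fun i => congrFun hv (i, c)

/-! ### Directed rooted spanning trees -/

section DirectedTree

variable {α : Type*} {T : Digraph α}

theorem IsDirectedRootedSpanningTree.eq_of_adj (hT : IsDirectedRootedSpanningTree T) {a a' b : α}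
    (h : T.Adj a b) (h' : T.Adj a' b) : a = a' := by
  obtain ⟨-, -, root, hroot, huniq⟩ := hT
  exact (huniq b fun hb => hroot a (hb ▸ h)).unique h h'

/-- Follow an undirected path from the root. An edge b – c traversed against its arc c → b leads to
the unique predecessor of b, which the directed path to b has already visited. -/
theorem IsDirectedRootedSpanningTree.exists_root_reaches (hT : IsDirectedRootedSpanningTree T) :
    ∃ root, ∀ b, Relation.ReflTransGen T.Adj root b := by
  have huniq : ∀ {a a' b : α}, T.Adj a b → T.Adj a' b → a = a' := hT.eq_of_adj
  obtain ⟨-, htree, root, hroot, -⟩ := hT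
  refine ⟨root, fun b => ?_⟩
  have hb := (SimpleGraph.reachable_iff_reflTransGen root b).1 (htree.connected root b)
  induction hb with
  | refl => exact .refl
  | @tail b c _ hbc ih =>
    rcases hbc.2 with h | h
    · exact ih.tail h
    · rcases ih.cases_tail with h0 | ⟨d, hd, hdb⟩
      · exact absurd (h0 ▸ h) (hroot c)
      · exact huniq hdb h ▸ hd

end DirectedTree

/-- `T` is a connected spanning subgraph of a tree, and a tree is minimal among connected graphs. -/
theorem Interconnection.adj_or_adj_of_underlyingGraph_adj {q r s : ℕ} {K : Interconnection q r s}
    (hK : K.underlyingGraph.IsTree) {T : Digraph (Fin q)} (hTK : T ≤ K.digraph)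
    (hT : IsDirectedRootedSpanningTree T) {i j : Fin q} (hij : K.underlyingGraph.Adj i j) :
    T.Adj i j ∨ T.Adj j i := by
  have hle : T.toSimpleGraphInclusive ≤ K.underlyingGraph := by
    intro a b hab
    refine ⟨hab.1, ?_⟩
    rcases hab.2 with h | h
    · exact add_pos_of_nonneg_of_pos (K.w_nonneg a b hab.1) (hTK h).2
    · exact add_pos_of_pos_of_nonneg (hTK h).2 (K.w_nonneg b a hab.1.symm)
  have := (SimpleGraph.isTree_iff_minimal_connected.1 hK).2 hT.2.1.connected hle
  exact (this hij).2

theorem Interconnection.isLaplacian_laplacian {q r s : ℕ} (K : Interconnection q r s) :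
    IsLaplacian K.laplacian where
  nonpos i j h := by
    rw [Interconnection.laplacian, Matrix.of_apply, if_neg h]
    exact neg_nonpos.2 (K.w_nonneg i j h)
  row_sum i := by
    rw [← Finset.sum_erase_add _ _ (Finset.mem_univ i)]
    simp only [Interconnection.laplacian, Matrix.of_apply, if_true]
    rw [Finset.sum_congr rfl fun j hj => if_neg (Finset.ne_of_mem_erase hj).symm,
      Finset.sum_neg_distrib]
    ring

/-! ### Clustering of Laplacians and reachability -/

/-- Aggregating the vertices along a map `π` with nonnegative weights preserves Laplacians. -/
theorem IsLaplacian.project {ι κ : Type*} [Fintype ι] [Fintype κ] [DecidableEq κ]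
    {M : Matrix ι ι ℝ} (hM : IsLaplacian M) (π : ι → κ) {V W : Matrix ι κ ℝ}
    (hV : ∀ k a, V k a = if π k = a then 1 else 0) (hW : ∀ k a, 0 ≤ W k a)
    (hW0 : ∀ k a, π k ≠ a → W k a = 0) : IsLaplacian (Wᵀ * M * V) where
  nonpos a b hab := by
    rw [Matrix.mul_assoc]
    simp only [Matrix.mul_apply, Matrix.transpose_apply, hV]
    refine Finset.sum_nonpos fun k _ => ?_
    by_cases hk : π k = a
    · refine mul_nonpos_of_nonneg_of_nonpos (hW k a) (Finset.sum_nonpos fun l _ => ?_)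
      split_ifs with hl
      · rw [mul_one]
        exact hM.nonpos k l fun h => hab (by rw [← hk, ← hl, h])
      · rw [mul_zero]
    · rw [hW0 k a hk, zero_mul]
  row_sum a := by
    have h1 : ∀ k, ∑ b, V k b = 1 := fun k => by simp [hV]
    rw [Matrix.mul_assoc]
    simp only [Matrix.mul_apply, Matrix.transpose_apply]
    rw [Finset.sum_comm]
    refine Finset.sum_eq_zero fun k _ => ?_
    rw [← Finset.mul_sum, Finset.sum_comm]
    simp_rw [← Finset.mul_sum, h1, mul_one, hM.row_sum, mul_zero]

/-- All contributions to the aggregated entry are nonpositive, so one strict term suffices. Only the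
head needs a positive weight in `W`; the tail enters through `V` with weight 1. -/
theorem IsLaplacian.hasArc_project {ι κ : Type*} [Fintype ι] [Fintype κ] [DecidableEq κ]
    {M : Matrix ι ι ℝ} (hM : IsLaplacian M) {π : ι → κ} {V W : Matrix ι κ ℝ}
    (hV : ∀ k a, V k a = if π k = a then 1 else 0) (hW : ∀ k a, 0 ≤ W k a)
    (hW0 : ∀ k a, π k ≠ a → W k a = 0) {l k : ι} (hlk : π l ≠ π k) (h : HasArc M l k)
    (hWk : 0 < W k (π k)) : HasArc (Wᵀ * M * V) (π l) (π k) := by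
  refine ⟨hlk, ?_⟩
  rw [Matrix.mul_assoc]
  simp only [Matrix.mul_apply, Matrix.transpose_apply, hV]
  have hin : ∀ k', π k' = π k → ∀ l' ∈ Finset.univ,
      M k' l' * (if π l' = π l then 1 else 0) ≤ 0 := by
    intro k' hk' l' _
    split_ifs with hl
    · rw [mul_one]
      exact hM.nonpos k' l' fun h => hlk (by rw [← hk', ← hl, h])
    · rw [mul_zero]
  refine Finset.sum_neg' (fun k' _ => ?_) ⟨k, Finset.mem_univ k, ?_⟩
  · by_cases hk : π k' = π k
    · exact mul_nonpos_of_nonneg_of_nonpos (hW k' _) (Finset.sum_nonpos (hin k' hk))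
    · rw [hW0 k' _ hk, zero_mul]
  · refine mul_neg_of_pos_of_neg hWk (Finset.sum_neg' (hin k rfl) ⟨l, Finset.mem_univ l, ?_⟩)
    simpa using h.2

/-- The map from the vertices of a network to those of its one-step clustering. -/
def clusterMap (N : ℕ) (k : Fin (N + 2)) : Fin (N + 1) :=
  Fin.lastCases (Fin.last N) id k

theorem clusterMap_vj (N : ℕ) : clusterMap N (vj N) = Fin.last N := Fin.lastCases_last

theorem clusterMap_castSucc {N : ℕ} (a : Fin (N + 1)) : clusterMap N a.castSucc = a :=
  Fin.lastCases_castSucc _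

theorem projV_apply (N : ℕ) (k : Fin (N + 2)) (a : Fin (N + 1)) :
    projV N k a = if clusterMap N k = a then 1 else 0 := by
  induction k using Fin.lastCases with
  | last =>
    rw [clusterMap_vj, projV, Matrix.of_apply]
    by_cases ha : a = Fin.last N
    · simp [ha]
    · rw [if_neg ha, if_neg (Ne.symm ha), if_neg (Fin.castSucc_ne_last a).symm]
  | cast k =>
    rw [clusterMap_castSucc, projV, Matrix.of_apply]
    by_cases ha : a = Fin.last N
    · simp [ha, Fin.castSucc_ne_last]
    · simp [ha]

theorem projW_nonneg {N r s : ℕ} (K : Interconnection (N + 2) r s) (k : Fin (N + 2))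
    (a : Fin (N + 1)) : 0 ≤ projW K.w k a := by
  have hne : vi N ≠ vj N := Fin.castSucc_ne_last _
  have h1 := K.w_nonneg _ _ hne
  have h2 := K.w_nonneg _ _ hne.symm
  rw [projW, Matrix.of_apply]
  split_ifs <;> positivity

theorem projW_eq_zero {N : ℕ} (w : Matrix (Fin (N + 2)) (Fin (N + 2)) ℝ) (k : Fin (N + 2))
    (a : Fin (N + 1)) (h : clusterMap N k ≠ a) : projW w k a = 0 := by
  induction k using Fin.lastCases with
  | last =>
    rw [clusterMap_vj] at h
    rw [projW, Matrix.of_apply, if_neg h.symm, if_neg (Fin.castSucc_ne_last a).symm]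
  | cast k =>
    rw [clusterMap_castSucc] at h
    rw [projW, Matrix.of_apply]
    by_cases ha : a = Fin.last N
    · subst ha
      simp [h, Fin.castSucc_ne_last]
    · simp [ha, h]

/-- Unmerged vertices have weight 1; a merged vertex has positive weight as soon as it has an arc to
its partner. -/
theorem projW_pos {N : ℕ} {w : Matrix (Fin (N + 2)) (Fin (N + 2)) ℝ}
    (hw : 0 < w (vi N) (vj N) + w (vj N) (vi N)) {k : Fin (N + 2)}
    (hi : k = vi N → 0 < w (vj N) (vi N)) (hj : k = vj N → 0 < w (vi N) (vj N)) :
    0 < projW w k (clusterMap N k) := by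
  induction k using Fin.lastCases with
  | last =>
    rw [clusterMap_vj, projW, Matrix.of_apply, if_pos rfl, if_neg (Fin.castSucc_ne_last _).symm,
      if_pos rfl]
    exact div_pos (hj rfl) hw
  | cast k =>
    rw [clusterMap_castSucc, projW, Matrix.of_apply]
    by_cases hk : k = Fin.last N
    · subst hk
      rw [if_pos rfl, if_pos rfl]
      exact div_pos (hi rfl) hw
    · simp [hk]

theorem isLaplacian_clustered {N r s : ℕ} (K : Interconnection (N + 2) r s) :
    IsLaplacian ((projW K.w)ᵀ * K.laplacian * projV N) :=
  K.isLaplacian_laplacian.project (clusterMap N) (projV_apply N) (projW_nonneg K)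
    (projW_eq_zero K.w)

/-- Under the tree assumption, some vertex of the clustered network reaches all others. -/
theorem exists_root_reaches_clustered {N r s : ℕ} {K : Interconnection (N + 2) r s}
    (hK : K.TreeAssumption) (hij : K.underlyingGraph.Adj (vi N) (vj N)) :
    ∃ ρ, ∀ a, Relation.ReflTransGen (HasArc ((projW K.w)ᵀ * K.laplacian * projV N)) ρ a := by
  obtain ⟨hu, T, hTK, hT⟩ := hK
  obtain ⟨root, hroot⟩ := hT.exists_root_reaches
  refine ⟨clusterMap N root, fun a => ?_⟩
  rw [← clusterMap_castSucc a]
  refine (hroot a.castSucc).lift' (clusterMap N) fun l k hlk => ?_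
  by_cases h : clusterMap N l = clusterMap N k
  · exact Relation.reflTransGen_iff_eq_or_transGen.2 (.inl h.symm)
  refine .single (K.isLaplacian_laplacian.hasArc_project (projV_apply N) (projW_nonneg K)
    (projW_eq_zero K.w) h ?_ ?_)
  · obtain ⟨h1, h2⟩ := hTK hlk
    refine ⟨h1, ?_⟩
    rw [Interconnection.laplacian, Matrix.of_apply, if_neg h1.symm]
    linarith
  · have hor := Interconnection.adj_or_adj_of_underlyingGraph_adj hu hTK hT hij
    have hc : clusterMap N (vi N) = clusterMap N (vj N) := by
      rw [clusterMap_vj, clusterMap_castSucc]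
    -- If `T` points from the head `k` to its partner, the weight of `k` is positive. Otherwise the
    -- partner is the unique predecessor of `k`, hence equals `l`, and the arc lies inside the
    -- cluster, contradicting `h`.
    refine projW_pos hij.2 (fun hk => ?_) (fun hk => ?_)
    · subst hk
      rcases hor with h' | h'
      · exact (hTK h').2
      · exact absurd (hT.eq_of_adj hlk h' ▸ hc.symm) h
    · subst hk
      rcases hor with h' | h'
      · exact absurd (hT.eq_of_adj hlk h' ▸ hc) h
      · exact (hTK h').2

end ClusteredNetwork

theorem mainTheorem2 {n m N r s : ℕ}
    (P : ClusteredNetwork.PortHamiltonian n m) (hmin : P.toLinearSystem.IsMinimal)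
    (K : ClusteredNetwork.Interconnection (N + 2) r s) (hK : K.TreeAssumption)
    (hij : K.underlyingGraph.Adj (ClusteredNetwork.vi N) (ClusteredNetwork.vj N))
    (ξ : ℝ → Fin (N + 1) × Fin n → ℝ)
    (hξ : (ClusteredNetwork.clusteredSystem P K).IsTrajectory 0 ξ) :
    ∀ i j : Fin (N + 1),
      Tendsto (fun t : ℝ => (fun a : Fin n => ξ t (i, a)) - fun a : Fin n => ξ t (j, a))
        atTop (𝓝 0) := by
  obtain ⟨_, hρ⟩ := ClusteredNetwork.exists_root_reaches_clustered hK hij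
  exact ClusteredNetwork.tendsto_sub_of_isLaplacian hmin.2
    (ClusteredNetwork.isLaplacian_clustered K) hρ hξ
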